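/- Let $\Omega\subseteq\mathbb{R}^n$ be open and connected, let $S(m)$ be the space of real symmetric $m\times m$ matrices, and let $H\in C^1(\Omega,S(m))$. For $x\in\Omega$ let $\lambda_1(x)\le\dots\le\lambda_m(x)$ be the eigenvalues of $H(x)$ repeated according to multiplicity, and let $P_i(x)$ be the symmetric matrix of the orthogonal projection of $\mathbb{R}^m$ onto the eigenspace $\{\xi\in\mathbb{R}^m : H(x)\xi=\lambda_i(x)\xi\}$. For $1\le j\le m$ let $$A_j(x)=\sum_{\substack{1\le i\le m\\ \lambda_i(x)\ne\lambda_j(x)}}\frac{P_i(x)/d_i(x)}{\lambda_j(x)-\lambda_i(x)},\qquad d_i(x)=\operatorname{tr}P_i(x),$$ which is the pseudoinverse of $\lambda_j(x)I-H(x)$. For a differentiable $F\colon\Omega\to\mathbb{R}^{m\times k}$, $q\in\mathbb{R}^k$ and $e\in\mathbb{R}^n$, let $\nabla_qF(x)\in\mathbb{R}^{m\times n}$ denote the Jacobian matrix at $x$ of $y\mapsto F(y)q$, and let $D_eF(x)=\lim_{h\to0}\big(F(x+he)-F(x)\big)/h\in\mathbb{R}^{m\times k}$. Fix $j\in\{1,\dots,m\}$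 and assume that either $P_j$ is continuous in $\Omega$, or $\lambda_j$ is differentiable in $\Omega$ and $\operatorname{tr}P_j$ is constant in $\Omega$. Then $P_j$ is differentiable in $\Omega$, and for all $x\in\Omega$, $q\in\mathbb{R}^m$ and $e\in\mathbb{R}^n$, $$\nabla_qP_j(x)=P_j(x)\,\nabla_{A_j(x)q}H(x)+A_j(x)\,\nabla_{P_j(x)q}H(x)$$ and $$D_eP_j(x)=P_j(x)\,D_eH(x)\,A_j(x)+A_j(x)\,D_eH(x)\,P_j(x),$$ where $\nabla_{A_j(x)q}H(x)$ and $\nabla_{P_j(x)q}H(x)$ mean $\nabla_pH(x)$ with the fixed vector $p=A_j(x)q$, respectively $p=P_j(x)q$. -/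

import Mathlib

open scoped Matrix.Norms.Frobenius

noncomputable section

namespace Eigenproj

/-- The space `S(m)` of real symmetric `m × m` matrices, normed by the Frobenius norm. -/
def SymMat (m : ℕ) : Submodule ℝ (Matrix (Fin m) (Fin m) ℝ) where
  carrier := {X | X.transpose = X}
  add_mem' := by
    intro X Y hX hY
    simp only [Set.mem_ofPred_eq] at *
    rw [Matrix.transpose_add, hX, hY]
  zero_mem' := Matrix.transpose_zero
  smul_mem' := by
    intro c X hX
    simp only [Set.mem_ofPred_eq] at *
    rw [Matrix.transpose_smul, hX]

theorem SymMat.isHermitian {m : ℕ} (X : SymMat m) :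
    (X : Matrix (Fin m) (Fin m) ℝ).IsHermitian := by
  have h : (X : Matrix (Fin m) (Fin m) ℝ).transpose = X := X.2
  rw [Matrix.IsHermitian, Matrix.conjTranspose_eq_transpose_of_trivial, h]

/-- The repeated eigenvalues `λ_1 ≤ ⋯ ≤ λ_m` of a symmetric matrix, in increasing order and
counted with multiplicity. (Mathlib's `eigenvalues₀` lists them in decreasing order.) -/
def eigval {m : ℕ} (X : SymMat m) (i : Fin m) : ℝ :=
  (SymMat.isHermitian X).eigenvalues₀ (Fin.cast (Fintype.card_fin m).symm i.rev)

/-- The eigenspace `E_i = {ξ | X ξ = λ_i ξ}` in Euclidean space. -/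
def eigspace {m : ℕ} (X : SymMat m) (i : Fin m) : Submodule ℝ (EuclideanSpace ℝ (Fin m)) :=
  Module.End.eigenspace (Matrix.toEuclideanLin (X : Matrix (Fin m) (Fin m) ℝ)) (eigval X i)

/-- The eigenprojection `P_i`: the matrix of the orthogonal projection onto `E_i`. -/
def eigproj {m : ℕ} (X : SymMat m) (i : Fin m) : Matrix (Fin m) (Fin m) ℝ :=
  Matrix.toEuclideanLin.symm
    ((eigspace X i).starProjection :
      EuclideanSpace ℝ (Fin m) →ₗ[ℝ] EuclideanSpace ℝ (Fin m))

/-- The pseudoinverse `A_j` of `λ_j I - X`: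
`A_j = ∑_{i : λ_i ≠ λ_j} (P_i / d_i) / (λ_j - λ_i)` with `d_i = tr P_i`. -/
def pseudoInv {m : ℕ} (X : SymMat m) (j : Fin m) : Matrix (Fin m) (Fin m) ℝ :=
  ∑ i with eigval X i ≠ eigval X j,
    ((eigproj X i).trace * (eigval X j - eigval X i))⁻¹ • eigproj X i

/-- The Jacobian matrix of `f` at `x`: its `a`-th column is the derivative of `f` at `x` applied to
the `a`-th standard basis vector. -/
def jacobian {n k : ℕ} (f : EuclideanSpace ℝ (Fin n) → EuclideanSpace ℝ (Fin k))
    (x : EuclideanSpace ℝ (Fin n)) : Matrix (Fin k) (Fin n) ℝ :=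
  Matrix.of fun i a => fderiv ℝ f x (EuclideanSpace.single a 1) i

/-- The Jacobian derivative `∇_q F (x)`: the Jacobian matrix at `x` of `y ↦ F(y) q`. -/
def nabla {n m k : ℕ} (q : Fin k → ℝ)
    (F : EuclideanSpace ℝ (Fin n) → Matrix (Fin m) (Fin k) ℝ)
    (x : EuclideanSpace ℝ (Fin n)) : Matrix (Fin m) (Fin n) ℝ :=
  jacobian (fun y => WithLp.toLp 2 ((F y).mulVec q)) x

/-- The directional derivative `D_e F (x) = lim_{h → 0} (F(x + h e) - F(x)) / h`. -/
def dirDeriv {n m k : ℕ} (e : EuclideanSpace ℝ (Fin n))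
    (F : EuclideanSpace ℝ (Fin n) → Matrix (Fin m) (Fin k) ℝ)
    (x : EuclideanSpace ℝ (Fin n)) : Matrix (Fin m) (Fin k) ℝ :=
  lineDeriv ℝ F x e

end Eigenproj

end

/-!
Let `P`, `P₀` be the eigenprojections of `X`, `X₀` for the eigenvalues `λ`, `λ₀`, and let `S` be
the pseudoinverse of `λ₀ - X₀`. The eigenvalue equation for `P` gives `(1 - P₀) P = S K P` and
`P (1 - P₀) = P K S` with `K = X - X₀ - (λ - λ₀)`, and `P² = P` makes the corner
`P₀ (P - P₀) P₀ = -P₀ (P - P₀)² P₀` quadratically small. As `S P₀ = P₀ S = 0`, the scalar part of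
`K` drops out to first order, so `P - P₀ = P₀ (X - X₀) S + S (X - X₀) P₀ + o(P - P₀)` as soon as
`P` is continuous.

Continuity of `P` follows from that of its trace, that is, from local constancy of its rank: the
eigenvalues are continuous by Weyl's inequality, so `(1 - P₀) P = S K P → 0`, and
`‖P - P₀‖² = tr P₀ - tr P + 2 tr ((1 - P₀) P)` in the Frobenius norm.
-/

namespace Eigenproj

open Asymptotics Filter Matrix Topology

section FirstOrder

variable {𝕜 E F G : Type*} [NontriviallyNormedField 𝕜] [NormedAddCommGroup E] [NormedSpace 𝕜 E]
  [NormedAddCommGroup F] [NormedSpace 𝕜 F] [NormedAddCommGroup G] [NormedSpace 𝕜 G]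

theorem hasFDerivAt_of_isLittleO_self {f : E → F} {g : E → G} {g' : E →L[𝕜] G} {x : E}
    (B : G →L[𝕜] F) (hg : HasFDerivAt g g' x)
    (hf : (fun y => f y - f x - B (g y - g x)) =o[𝓝 x] fun y => f y - f x) :
    HasFDerivAt f (B ∘L g') x := by
  have hBg : (fun y => B (g y - g x)) =O[𝓝 x] fun y => y - x :=
    (B.isBigO_comp _ _).trans hg.isBigO_sub
  have hf_lip : (fun y => f y - f x) =O[𝓝 x] fun y => y - x :=
    hf.right_isBigO_sub.trans (hBg.congr_left fun _ => (sub_sub_cancel _ _).symm)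
  refine .of_isLittleO (((hf.trans_isBigO hf_lip).add
    ((B.isBigO_comp _ _).trans_isLittleO hg.isLittleO)).congr_left fun y => ?_)
  simp only [map_sub, ContinuousLinearMap.comp_apply]
  abel

end FirstOrder

section ReducedResolvent

variable {𝕜 A : Type*} [CommRing 𝕜] [Ring A] [Algebra 𝕜 A]

/-- An algebraic form of the projection onto an eigenspace: `P` is an idempotent commuting with `X`
on whose range `X` acts as the scalar `l`. That this range is the full eigenspace is not demanded;
the existence of a reduced resolvent implies it. -/
structure IsEigenprojection (X : A) (l : 𝕜) (P : A) : Prop where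
  idem : IsIdempotentElem P
  mul_eq : X * P = l • P
  eq_mul : P * X = l • P

/-- `S` is the reduced resolvent (in Kato's sense, up to sign) of `X` at `l` with respect to the
idempotent `P`: it inverts `l • 1 - X` on the kernel of `P` and vanishes on the range of `P`. -/
structure IsReducedResolvent (X : A) (l : 𝕜) (P S : A) : Prop where
  left_eq : S * (l • 1 - X) = 1 - P
  right_eq : (l • 1 - X) * S = 1 - P
  mul_proj : S * P = 0
  proj_mul : P * S = 0

variable {X X₀ P P₀ S : A} {l l₀ : 𝕜}

theorem IsReducedResolvent.one_sub_mul (hS : IsReducedResolvent X₀ l₀ P₀ S) (hP : X * P = l • P) :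
    (1 - P₀) * P = S * (X - X₀ - (l - l₀) • 1) * P := by
  rw [← hS.left_eq, mul_assoc, mul_assoc]
  simp only [sub_mul, hP, smul_one_mul, sub_smul]
  abel_nf

theorem IsReducedResolvent.mul_one_sub (hS : IsReducedResolvent X₀ l₀ P₀ S) (hP : P * X = l • P) :
    P * (1 - P₀) = P * (X - X₀ - (l - l₀) • 1) * S := by
  rw [← hS.right_eq, ← mul_assoc]
  simp only [mul_sub, hP, mul_smul_one, sub_smul]
  abel_nf

theorem IsEigenprojection.sub_eq (hP : IsEigenprojection X l P) (hP₀ : IsIdempotentElem P₀)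
    (hS : IsReducedResolvent X₀ l₀ P₀ S) :
    P - P₀ = P₀ * (X - X₀) * S + S * (X - X₀) * P₀ +
      (S * (X - X₀ - (l - l₀) • 1) * (P - P₀) + P₀ * (P - P₀) * (X - X₀ - (l - l₀) • 1) * S -
        P₀ * (P - P₀) * (P - P₀) * P₀) := by
  set K := X - X₀ - (l - l₀) • 1 with hK
  have left : (1 - P₀) * P = S * (X - X₀) * P₀ + S * K * (P - P₀) := by
    have hKP₀ : S * K * P₀ = S * (X - X₀) * P₀ := by
      simp only [hK, mul_sub, sub_mul, mul_smul_one, smul_mul_assoc, hS.mul_proj,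
        smul_zero, sub_zero]
    rw [hS.one_sub_mul hP.mul_eq, ← hKP₀, ← mul_add, add_sub_cancel]
  have right : P₀ * (P * (1 - P₀)) = P₀ * (X - X₀) * S + P₀ * (P - P₀) * K * S := by
    have hP₀K : P₀ * K * S = P₀ * (X - X₀) * S := by
      simp only [hK, mul_sub, sub_mul, mul_smul_one, smul_mul_assoc, hS.proj_mul,
        smul_zero, sub_zero]
    rw [hS.mul_one_sub hP.eq_mul, ← hK, ← hP₀K]
    simp only [mul_sub, sub_mul, hP₀.eq, mul_assoc]
    abel
  have corner : P₀ * (P - P₀) * (P - P₀) * P₀ = P₀ - P₀ * P * P₀ := by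
    have hPP : P₀ * P * P = P₀ * P := by rw [mul_assoc, hP.idem.eq]
    have hPP₀ : P₀ * P * P₀ * P₀ = P₀ * P * P₀ := by rw [mul_assoc, hP₀.eq]
    simp only [mul_sub, sub_mul, hP₀.eq, hPP, hPP₀]
    abel
  calc P - P₀ = (1 - P₀) * P + P₀ * (P * (1 - P₀)) - (P₀ - P₀ * P * P₀) := by noncomm_ring
    _ = _ := by rw [left, right, corner]; abel

end ReducedResolvent

section Derivative

variable {𝕜 E A : Type*} [NontriviallyNormedField 𝕜] [NormedAddCommGroup E] [NormedSpace 𝕜 E]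
  [NormedRing A] [NormedAlgebra 𝕜 A]

theorem IsEigenprojection.hasFDerivAt {X P : E → A} {l : E → 𝕜} {x : E} {S : A} {X' : E →L[𝕜] A}
    (hP : ∀ᶠ y in 𝓝 x, IsEigenprojection (X y) (l y) (P y))
    (hS : IsReducedResolvent (X x) (l x) (P x) S) (hX : HasFDerivAt X X' x)
    (hl : ContinuousAt l x) (hPc : ContinuousAt P x) :
    HasFDerivAt P
      ((ContinuousLinearMap.mulLeftRight 𝕜 A (P x) S +
        ContinuousLinearMap.mulLeftRight 𝕜 A S (P x)) ∘L X') x := by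
  let R y := P y - P x
  let K y := X y - X x - (l y - l x) • (1 : A)
  have hR : R =o[𝓝 x] fun _ => (1 : ℝ) :=
    (isLittleO_one_iff ℝ).mpr (tendsto_sub_nhds_zero_iff.mpr hPc)
  have hK : K =o[𝓝 x] fun _ => (1 : ℝ) := by
    have hK_cont : ContinuousAt K x := by have := hX.continuousAt; fun_prop
    simpa [K, ContinuousAt, isLittleO_one_iff] using hK_cont
  have hRR : R =O[𝓝 x] fun y => ‖R y‖ := (isBigO_refl R _).norm_right
  have hconst (M : A) : (fun _ : E => M) =O[𝓝 x] fun _ => (1 : ℝ) :=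
    isBigO_const_const _ one_ne_zero _
  have hSKR : (fun y => S * K y * R y) =o[𝓝 x] fun y => ‖R y‖ := by
    simpa using ((hconst S).mul_isLittleO hK).mul_isBigO hRR
  have hPRKS : (fun y => P x * R y * K y * S) =o[𝓝 x] fun y => ‖R y‖ := by
    simpa using (((hconst (P x)).mul hRR).mul_isLittleO hK).mul_isBigO (hconst S)
  have hPRRP : (fun y => P x * R y * R y * P x) =o[𝓝 x] fun y => ‖R y‖ := by
    simpa using (((hconst (P x)).mul hRR).mul_isLittleO hR).mul_isBigO (hconst (P x))
  refine hasFDerivAt_of_isLittleO_self _ hX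
    (((hSKR.add hPRKS).sub hPRRP).of_norm_right.congr' ?_ .rfl)
  filter_upwards [hP] with y hy
  simp only [_root_.add_apply, ContinuousLinearMap.mulLeftRight_apply]
  rw [eq_sub_iff_add_eq']
  exact (hy.sub_eq hP.self_of_nhds.idem hS).symm

end Derivative

section StarProjection

variable {𝕜 n : Type*} [RCLike 𝕜] [Fintype n]

theorem frobenius_norm_sq_eq_trace {m : Type*} [Fintype m] (M : Matrix m n 𝕜) :
    ((‖M‖ ^ 2 : ℝ) : 𝕜) = (Mᴴ * M).trace := by
  have hnonneg : 0 ≤ ∑ i, ∑ k, ‖M i k‖ ^ (2 : ℝ) := by positivity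
  rw [frobenius_norm_def, ← Real.sqrt_eq_rpow, Real.sq_sqrt hnonneg, Finset.sum_comm]
  simp [trace, mul_apply, RCLike.conj_mul]

theorem frobenius_norm_sq_of_isStarProjection {P : Matrix n n 𝕜} (hP : IsStarProjection P) :
    ((‖P‖ ^ 2 : ℝ) : 𝕜) = P.trace := by
  rw [frobenius_norm_sq_eq_trace, ← star_eq_conjTranspose, hP.isSelfAdjoint.star_eq,
    hP.isIdempotentElem.eq]

theorem frobenius_norm_sq_sub_of_isStarProjection [DecidableEq n] {P Q : Matrix n n 𝕜}
    (hP : IsStarProjection P) (hQ : IsStarProjection Q) :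
    ((‖P - Q‖ ^ 2 : ℝ) : 𝕜) = Q.trace - P.trace + 2 * ((1 - Q) * P).trace := by
  rw [frobenius_norm_sq_eq_trace, ← star_eq_conjTranspose, star_sub, hP.isSelfAdjoint.star_eq,
    hQ.isSelfAdjoint.star_eq]
  simp only [sub_mul, mul_sub, one_mul, trace_sub, hP.isIdempotentElem.eq, hQ.isIdempotentElem.eq,
    trace_mul_comm P Q]
  ring

theorem tendsto_of_isStarProjection [DecidableEq n] {ι : Type*} {f : Filter ι}
    {P : ι → Matrix n n 𝕜} {Q : Matrix n n 𝕜} (hP : ∀ᶠ i in f, IsStarProjection (P i))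
    (hQ : IsStarProjection Q) (htr : Tendsto (fun i => (P i).trace) f (𝓝 Q.trace))
    (hcompl : Tendsto (fun i => (1 - Q) * P i) f (𝓝 0)) : Tendsto P f (𝓝 Q) := by
  have hcompl_tr : Tendsto (fun i => ((1 - Q) * P i).trace) f (𝓝 0) := by
    rw [← trace_zero n 𝕜]
    exact (continuous_id.matrix_trace.tendsto 0).comp hcompl
  have hsq : Tendsto (fun i => ((‖P i - Q‖ ^ 2 : ℝ) : 𝕜)) f (𝓝 0) := by
    have := (htr.const_sub Q.trace).add (hcompl_tr.const_mul 2)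
    rw [sub_self, mul_zero, add_zero] at this
    refine this.congr' ?_
    filter_upwards [hP] with i hi
    exact (frobenius_norm_sq_sub_of_isStarProjection hi hQ).symm
  refine tendsto_iff_norm_sub_tendsto_zero.mpr ?_
  simpa using! ((RCLike.continuous_re.tendsto 0).comp hsq).sqrt

end StarProjection

section Weyl

variable {ι E : Type*} [Fintype ι] [NormedAddCommGroup E] [InnerProductSpace ℝ E]

open scoped InnerProductSpace

theorem inner_apply_eq_sum_of_apply_basis (b : OrthonormalBasis ι ℝ E) {T : E →ₗ[ℝ] E} {μ : ι → ℝ}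
    (hT : ∀ k, T (b k) = μ k • b k) (v : E) : ⟪v, T v⟫_ℝ = ∑ k, μ k * ⟪b k, v⟫_ℝ ^ 2 := by
  have hTv : T v = ∑ k, (⟪b k, v⟫_ℝ * μ k) • b k := by
    conv_lhs => rw [← b.sum_repr' v]
    simp only [map_sum, map_smul, hT, smul_smul]
  rw [hTv, inner_sum]
  refine Finset.sum_congr rfl fun k _ => ?_
  rw [real_inner_smul_right, real_inner_comm]
  ring

theorem exists_ne_zero_inner_eq_zero [LinearOrder ι] (b b' : OrthonormalBasis ι ℝ E) (j : ι) :
    ∃ v ≠ 0, (∀ k < j, ⟪b k, v⟫_ℝ = 0) ∧ ∀ k > j, ⟪b' k, v⟫_ℝ = 0 := by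
  let c (k : {k // k ≠ j}) : E := if (k : ι) < j then b k else b' k
  let f : E →ₗ[ℝ] {k // k ≠ j} → ℝ := LinearMap.pi fun k => (innerSL ℝ (c k)).toLinearMap
  have : FiniteDimensional ℝ E := b.toBasis.finiteDimensional_of_finite
  have hdim : Module.finrank ℝ ({k // k ≠ j} → ℝ) < Module.finrank ℝ E := by
    rw [Module.finrank_fintype_fun_eq_card, Module.finrank_eq_card_basis b.toBasis]
    exact Fintype.card_subtype_lt (x := j) (by simp)
  obtain ⟨v, hv, hv0⟩ := Submodule.exists_mem_ne_zero_of_ne_bot (f.ker_ne_bot_of_finrank_lt hdim)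
  have hc (k : ι) (hk : k ≠ j) : ⟪c ⟨k, hk⟩, v⟫_ℝ = 0 :=
    congrFun (LinearMap.mem_ker.mp hv) ⟨k, hk⟩
  exact ⟨v, hv0, fun k hk => by simpa [c, hk] using hc k hk.ne,
    fun k hk => by simpa [c, hk.not_gt] using hc k hk.ne'⟩

theorem le_add_opNorm_of_apply_basis [LinearOrder ι] {b b' : OrthonormalBasis ι ℝ E}
    {T T' : E →L[ℝ] E} {μ μ' : ι → ℝ} (hμ : Monotone μ) (hμ' : Monotone μ')
    (hT : ∀ k, T (b k) = μ k • b k) (hT' : ∀ k, T' (b' k) = μ' k • b' k) (j : ι) :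
    μ j ≤ μ' j + ‖T - T'‖ := by
  obtain ⟨v, hv0, hv, hv'⟩ := exists_ne_zero_inner_eq_zero b b' j
  have lower : μ j * ‖v‖ ^ 2 ≤ ⟪v, T v⟫_ℝ := by
    rw [← b.sum_sq_inner_right v, Finset.mul_sum]
    refine le_of_le_of_eq ?_ (inner_apply_eq_sum_of_apply_basis b (T := T) hT v).symm
    refine Finset.sum_le_sum fun k _ => ?_
    rcases lt_or_ge k j with hk | hk
    · simp [hv k hk]
    · gcongr; exact hμ hk
  have upper : ⟪v, T' v⟫_ℝ ≤ μ' j * ‖v‖ ^ 2 := by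
    rw [← b'.sum_sq_inner_right v, Finset.mul_sum]
    refine (inner_apply_eq_sum_of_apply_basis b' (T := T') hT' v).trans_le ?_
    refine Finset.sum_le_sum fun k _ => ?_
    rcases lt_or_ge j k with hk | hk
    · simp [hv' k hk]
    · gcongr; exact hμ' hk
  have diff : ⟪v, (T - T') v⟫_ℝ ≤ ‖T - T'‖ * ‖v‖ ^ 2 :=
    calc ⟪v, (T - T') v⟫_ℝ ≤ ‖v‖ * ‖(T - T') v‖ := real_inner_le_norm _ _
      _ ≤ ‖v‖ * (‖T - T'‖ * ‖v‖) := by gcongr; exact (T - T').le_opNorm v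
      _ = ‖T - T'‖ * ‖v‖ ^ 2 := by ring
  rw [_root_.sub_apply, inner_sub_right] at diff
  refine le_of_mul_le_mul_right ?_ (pow_pos (norm_pos_iff.mpr hv0) 2)
  linarith

end Weyl

section Diagonalization

variable {m : ℕ} (X : SymMat m) (j : Fin m)

/-- An orthonormal basis of eigenvectors of `X`, indexed like the increasing eigenvalues
`eigval X`. -/
noncomputable def eigenbasis : OrthonormalBasis (Fin m) ℝ (EuclideanSpace ℝ (Fin m)) :=
  ((isSymmetric_toEuclideanLin_iff.mpr (SymMat.isHermitian X)).eigenvectorBasis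
    finrank_euclideanSpace).reindex ((finCongr (Fintype.card_fin m)).trans Fin.revPerm)

theorem toEuclideanLin_eigenbasis (k : Fin m) :
    toEuclideanLin (X : Matrix (Fin m) (Fin m) ℝ) (eigenbasis X k) =
      eigval X k • eigenbasis X k := by
  rw [eigenbasis, OrthonormalBasis.reindex_apply]
  exact (isSymmetric_toEuclideanLin_iff.mpr (SymMat.isHermitian X)).apply_eigenvectorBasis
    finrank_euclideanSpace _

theorem eigval_monotone : Monotone (eigval X) := fun _ _ h =>
  (SymMat.isHermitian X).eigenvalues₀_antitone (Fin.rev_le_rev.mpr h)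

theorem continuous_eigval : Continuous fun X : SymMat m => eigval X j := by
  let T : SymMat m →ₗ[ℝ] (EuclideanSpace ℝ (Fin m) →L[ℝ] EuclideanSpace ℝ (Fin m)) :=
    (toEuclideanLin ≪≫ₗ LinearMap.toContinuousLinearMap).toLinearMap ∘ₗ (SymMat m).subtype
  have hT : Continuous T := T.continuous_of_finiteDimensional
  have weyl (X Y : SymMat m) : eigval X j ≤ eigval Y j + ‖T X - T Y‖ :=
    le_add_opNorm_of_apply_basis (eigval_monotone X) (eigval_monotone Y)
      (toEuclideanLin_eigenbasis X) (toEuclideanLin_eigenbasis Y) j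
  refine continuous_iff_continuousAt.mpr fun X => tendsto_iff_dist_tendsto_zero.mpr ?_
  refine squeeze_zero (fun _ => dist_nonneg) (fun Y => ?_)
    (tendsto_iff_dist_tendsto_zero.mp hT.continuousAt)
  rw [Real.dist_eq, dist_eq_norm, abs_sub_le_iff, sub_le_iff_le_add', sub_le_iff_le_add']
  exact ⟨weyl Y X, norm_sub_rev (T Y) (T X) ▸ weyl X Y⟩

theorem ext_of_apply_eigenbasis {M N : Matrix (Fin m) (Fin m) ℝ}
    (h : ∀ k, toEuclideanLin M (eigenbasis X k) = toEuclideanLin N (eigenbasis X k)) : M = N :=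
  toEuclideanLin.injective ((eigenbasis X).toBasis.ext fun k => by simpa using h k)

theorem toEuclideanLin_eigproj_eigenbasis (k : Fin m) :
    toEuclideanLin (eigproj X j) (eigenbasis X k) =
      if eigval X k = eigval X j then eigenbasis X k else 0 := by
  rw [eigproj, LinearEquiv.apply_symm_apply, ContinuousLinearMap.coe_coe]
  split_ifs with h
  · rw [Submodule.starProjection_eq_self_iff, eigspace, Module.End.mem_eigenspace_iff,
      toEuclideanLin_eigenbasis, h]
  · rw [Submodule.starProjection_apply_eq_zero_iff, Submodule.mem_orthogonal]
    intro v hv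
    rw [eigspace, Module.End.mem_eigenspace_iff] at hv
    have hsymm := isSymmetric_toEuclideanLin_iff.mpr (SymMat.isHermitian X) v (eigenbasis X k)
    rw [hv, toEuclideanLin_eigenbasis, inner_smul_left, inner_smul_right] at hsymm
    by_contra h0
    exact h (mul_right_cancel₀ h0 hsymm).symm

theorem isStarProjection_eigproj : IsStarProjection (eigproj X j) := by
  have hP : toEuclideanLin (eigproj X j) = (eigspace X j).starProjection :=
    toEuclideanLin.apply_symm_apply _
  refine ⟨ext_of_apply_eigenbasis X fun k => ?_, ?_⟩
  · simp +contextual [toEuclideanLin_eigproj_eigenbasis, apply_ite]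
  · rw [isSelfAdjoint_iff, star_eq_conjTranspose, ← IsHermitian, ← isSymmetric_toEuclideanLin_iff,
      hP]
    exact Submodule.starProjection_isSymmetric _

theorem isEigenprojection_eigproj :
    IsEigenprojection (X : Matrix (Fin m) (Fin m) ℝ) (eigval X j) (eigproj X j) where
  idem := (isStarProjection_eigproj X j).isIdempotentElem
  mul_eq := ext_of_apply_eigenbasis X fun k => by
    simp +contextual [toEuclideanLin_eigenbasis, toEuclideanLin_eigproj_eigenbasis, apply_ite]
  eq_mul := ext_of_apply_eigenbasis X fun k => by
    simp +contextual [toEuclideanLin_eigenbasis, toEuclideanLin_eigproj_eigenbasis, apply_ite]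

theorem trace_eigproj :
    (eigproj X j).trace = (Finset.univ.filter fun k => eigval X k = eigval X j).card := by
  rw [← trace_toLin_eq _ (PiLp.basisFun 2 ℝ (Fin m)), ← toLpLin_eq_toLin,
    LinearMap.trace_eq_sum_inner (toEuclideanLin (eigproj X j)) (eigenbasis X)]
  simp only [toEuclideanLin_eigproj_eigenbasis]
  simp [apply_ite]

-- For `eigval X k = eigval X j` the right-hand side vanishes, since `0⁻¹ = 0`.
theorem toEuclideanLin_pseudoInv_eigenbasis (k : Fin m) :
    toEuclideanLin (pseudoInv X j) (eigenbasis X k) =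
      (eigval X j - eigval X k)⁻¹ • eigenbasis X k := by
  set s := Finset.univ.filter fun i => eigval X i = eigval X k with hs
  have hcard : (s.card : ℝ) ≠ 0 := Nat.cast_ne_zero.mpr (Finset.card_ne_zero.mpr ⟨k, by simp [s]⟩)
  have hterm (i : Fin m) :
      ((eigproj X i).trace * (eigval X j - eigval X i))⁻¹ •
          toEuclideanLin (eigproj X i) (eigenbasis X k) =
        if eigval X i = eigval X k then
          (s.card * (eigval X j - eigval X k))⁻¹ • eigenbasis X k else 0 := by
    rw [toEuclideanLin_eigproj_eigenbasis, trace_eigproj]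
    by_cases h : eigval X i = eigval X k
    · simp only [h, hs, if_true]
    · simp only [h, Ne.symm h, if_false, smul_zero]
  simp only [pseudoInv, map_sum, map_smul, LinearMap.sum_apply, LinearMap.smul_apply, hterm]
  rw [← Finset.sum_filter, Finset.sum_const, Finset.filter_filter]
  by_cases h : eigval X k = eigval X j
  · simp [h]
  · have hfilter : (Finset.univ.filter fun i => eigval X i ≠ eigval X j ∧ eigval X i = eigval X k) =
        s := by
      ext i
      simp only [s, Finset.mem_filter_univ, and_iff_right_iff_imp]
      exact fun hi => hi ▸ h
    rw [hfilter, ← Nat.cast_smul_eq_nsmul ℝ, smul_smul, mul_inv, mul_inv_cancel_left₀ hcard]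

theorem isReducedResolvent_pseudoInv :
    IsReducedResolvent (X : Matrix (Fin m) (Fin m) ℝ) (eigval X j) (eigproj X j)
      (pseudoInv X j) := by
  have hgap (k : Fin m) (h : eigval X k ≠ eigval X j) : eigval X j - eigval X k ≠ 0 :=
    sub_ne_zero.mpr h.symm
  constructor <;> refine ext_of_apply_eigenbasis X fun k => ?_ <;>
    by_cases h : eigval X k = eigval X j <;>
    simp [toEuclideanLin_eigenbasis, toEuclideanLin_eigproj_eigenbasis,
      toEuclideanLin_pseudoInv_eigenbasis, h, ← sub_smul, smul_smul, hgap]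

end Diagonalization

section EigenprojCalculus

variable {m : ℕ} {j : Fin m}

theorem continuousAt_eigproj {E : Type*} [TopologicalSpace E] {H : E → SymMat m} {x : E}
    (hH : ContinuousAt H x) (htr : ContinuousAt (fun y => (eigproj (H y) j).trace) x) :
    ContinuousAt (fun y => eigproj (H y) j) x := by
  let S := pseudoInv (H x) j
  let K (y : E) : Matrix (Fin m) (Fin m) ℝ := (H y : Matrix (Fin m) (Fin m) ℝ) - H x -
    (eigval (H y) j - eigval (H x) j) • (1 : Matrix (Fin m) (Fin m) ℝ)
  have hSK : Tendsto (fun y => S * K y) (𝓝 x) (𝓝 0) := by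
    have hl : ContinuousAt (fun y => eigval (H y) j) x :=
      (continuous_eigval j).continuousAt.comp hH
    have hSK_cont : ContinuousAt (fun y => S * K y) x := by fun_prop
    simpa [K, ContinuousAt] using hSK_cont
  have hbdd : IsBoundedUnder (· ≤ ·) (𝓝 x) fun y => ‖eigproj (H y) j‖ := by
    have hnorm (y : E) : √(eigproj (H y) j).trace = ‖eigproj (H y) j‖ := by
      rw [← frobenius_norm_sq_of_isStarProjection (isStarProjection_eigproj (H y) j)]
      exact Real.sqrt_sq (norm_nonneg _)
    simpa only [hnorm] using htr.sqrt.isBoundedUnder_le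
  refine tendsto_of_isStarProjection (.of_forall fun y => isStarProjection_eigproj (H y) j)
    (isStarProjection_eigproj (H x) j) htr ?_
  refine (hSK.zero_mul_isBoundedUnder_le hbdd).congr fun y => ?_
  exact ((isReducedResolvent_pseudoInv (H x) j).one_sub_mul
    (isEigenprojection_eigproj (H y) j).mul_eq).symm

theorem exists_hasFDerivAt_eigproj {E : Type*} [NormedAddCommGroup E] [NormedSpace ℝ E]
    {H : E → SymMat m} {x : E} {H' : E →L[ℝ] Matrix (Fin m) (Fin m) ℝ}
    (hH : HasFDerivAt (fun y => (H y : Matrix (Fin m) (Fin m) ℝ)) H' x)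
    (htr : ContinuousAt (fun y => (eigproj (H y) j).trace) x) :
    ∃ P' : E →L[ℝ] Matrix (Fin m) (Fin m) ℝ, HasFDerivAt (fun y => eigproj (H y) j) P' x ∧
      ∀ e, P' e = eigproj (H x) j * H' e * pseudoInv (H x) j +
        pseudoInv (H x) j * H' e * eigproj (H x) j := by
  have hHc : ContinuousAt H x := Topology.IsInducing.subtypeVal.continuousAt_iff.mpr hH.continuousAt
  exact ⟨_, IsEigenprojection.hasFDerivAt (.of_forall fun y => isEigenprojection_eigproj (H y) j)
    (isReducedResolvent_pseudoInv (H x) j) hH ((continuous_eigval j).continuousAt.comp hHc)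
    (continuousAt_eigproj hHc htr), fun e => rfl⟩

end EigenprojCalculus

section Jacobian

variable {n m k : ℕ}

theorem jacobian_mulVec (f : EuclideanSpace ℝ (Fin n) → EuclideanSpace ℝ (Fin k))
    (x e : EuclideanSpace ℝ (Fin n)) : jacobian f x *ᵥ e = fderiv ℝ f x e := by
  ext i
  conv_rhs => rw [← (EuclideanSpace.basisFun (Fin n) ℝ).sum_repr e]
  simp [jacobian, mulVec, dotProduct, mul_comm]

theorem nabla_mulVec {F : EuclideanSpace ℝ (Fin n) → Matrix (Fin m) (Fin k) ℝ}
    {x : EuclideanSpace ℝ (Fin n)} (hF : DifferentiableAt ℝ F x) (q : Fin k → ℝ)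
    (e : EuclideanSpace ℝ (Fin n)) : nabla q F x *ᵥ e = dirDeriv e F x *ᵥ q := by
  let evalAt : Matrix (Fin m) (Fin k) ℝ →L[ℝ] EuclideanSpace ℝ (Fin m) :=
    LinearMap.toContinuousLinearMap
      (LinearMap.applyₗ (WithLp.toLp 2 q) ∘ₗ toEuclideanLin.toLinearMap)
  have hFq : HasFDerivAt (fun y => WithLp.toLp 2 (F y *ᵥ q)) (evalAt ∘L fderiv ℝ F x) x :=
    evalAt.hasFDerivAt.comp x hF.hasFDerivAt
  rw [nabla, jacobian_mulVec, hFq.fderiv, dirDeriv, hF.lineDeriv_eq_fderiv]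
  rfl

end Jacobian

end Eigenproj

open Eigenproj

theorem theorem3p1_general {n m : ℕ} (Ω : Set (EuclideanSpace ℝ (Fin n))) (hΩo : IsOpen Ω)
    (H : EuclideanSpace ℝ (Fin n) → SymMat m) (hH : DifferentiableOn ℝ H Ω) (j : Fin m)
    (htr : ContinuousOn (fun x => (eigproj (H x) j).trace) Ω) :
    DifferentiableOn ℝ (fun x => eigproj (H x) j) Ω ∧
    ∀ x ∈ Ω,
      (∀ q : Fin m → ℝ,
        nabla q (fun y => eigproj (H y) j) x =
          eigproj (H x) j *
              nabla ((pseudoInv (H x) j).mulVec q) (fun y => (H y : Matrix (Fin m) (Fin m) ℝ)) x +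
            pseudoInv (H x) j *
              nabla ((eigproj (H x) j).mulVec q) (fun y => (H y : Matrix (Fin m) (Fin m) ℝ)) x) ∧
      (∀ e : EuclideanSpace ℝ (Fin n),
        dirDeriv e (fun y => eigproj (H y) j) x =
          eigproj (H x) j * dirDeriv e (fun y => (H y : Matrix (Fin m) (Fin m) ℝ)) x *
              pseudoInv (H x) j +
            pseudoInv (H x) j * dirDeriv e (fun y => (H y : Matrix (Fin m) (Fin m) ℝ)) x *
              eigproj (H x) j) := by
  have hHm (x) (hx : x ∈ Ω) : DifferentiableAt ℝ (fun y => (H y : Matrix (Fin m) (Fin m) ℝ)) x :=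
    (SymMat m).subtypeL.differentiableAt.comp x (hH.differentiableAt (hΩo.mem_nhds hx))
  choose! P' hP' hP'_apply using fun x hx =>
    exists_hasFDerivAt_eigproj (hHm x hx).hasFDerivAt (htr.continuousAt (hΩo.mem_nhds hx))
  refine ⟨fun x hx => (hP' x hx).differentiableAt.differentiableWithinAt, fun x hx => ?_⟩
  have hD (e : EuclideanSpace ℝ (Fin n)) :
      dirDeriv e (fun y => eigproj (H y) j) x =
        eigproj (H x) j * dirDeriv e (fun y => (H y : Matrix (Fin m) (Fin m) ℝ)) x *
            pseudoInv (H x) j +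
          pseudoInv (H x) j * dirDeriv e (fun y => (H y : Matrix (Fin m) (Fin m) ℝ)) x *
            eigproj (H x) j := by
    rw [dirDeriv, dirDeriv, ((hP' x hx).hasLineDerivAt e).lineDeriv,
      (hHm x hx).lineDeriv_eq_fderiv]
    exact hP'_apply x hx e
  refine ⟨fun q => Matrix.mulVec_injective (funext fun v => ?_), hD⟩
  obtain ⟨e, rfl⟩ : ∃ e : EuclideanSpace ℝ (Fin n), e.ofLp = v := ⟨WithLp.toLp 2 v, rfl⟩
  rw [nabla_mulVec (hP' x hx).differentiableAt, hD]
  simp only [Matrix.add_mulVec, ← Matrix.mulVec_mulVec, nabla_mulVec (hHm x hx)]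

theorem theorem3p1 {n m : ℕ} (Ω : Set (EuclideanSpace ℝ (Fin n)))
    (hΩo : IsOpen Ω) (hΩc : IsConnected Ω)
    (H : EuclideanSpace ℝ (Fin n) → Eigenproj.SymMat m) (hH : ContDiffOn ℝ 1 H Ω)
    (j : Fin m)
    (hyp : ContinuousOn (fun x => Eigenproj.eigproj (H x) j) Ω ∨
      (DifferentiableOn ℝ (fun x => Eigenproj.eigval (H x) j) Ω ∧
        ∃ d : ℝ, ∀ x ∈ Ω, (Eigenproj.eigproj (H x) j).trace = d)) :
    DifferentiableOn ℝ (fun x => Eigenproj.eigproj (H x) j) Ω ∧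
    ∀ x ∈ Ω,
      (∀ q : Fin m → ℝ,
        Eigenproj.nabla q (fun y => Eigenproj.eigproj (H y) j) x =
          Eigenproj.eigproj (H x) j *
              Eigenproj.nabla ((Eigenproj.pseudoInv (H x) j).mulVec q)
                (fun y => (H y : Matrix (Fin m) (Fin m) ℝ)) x +
            Eigenproj.pseudoInv (H x) j *
              Eigenproj.nabla ((Eigenproj.eigproj (H x) j).mulVec q)
                (fun y => (H y : Matrix (Fin m) (Fin m) ℝ)) x) ∧
      (∀ e : EuclideanSpace ℝ (Fin n),
        Eigenproj.dirDeriv e (fun y => Eigenproj.eigproj (H y) j) x =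
          Eigenproj.eigproj (H x) j *
              Eigenproj.dirDeriv e (fun y => (H y : Matrix (Fin m) (Fin m) ℝ)) x *
              Eigenproj.pseudoInv (H x) j +
            Eigenproj.pseudoInv (H x) j *
              Eigenproj.dirDeriv e (fun y => (H y : Matrix (Fin m) (Fin m) ℝ)) x *
              Eigenproj.eigproj (H x) j) :=
  theorem3p1_general Ω hΩo H (hH.differentiableOn one_ne_zero) j
    (hyp.elim (fun hP => continuous_id.matrix_trace.comp_continuousOn hP)
      fun ⟨_, _, htr⟩ => continuousOn_const.congr htr)
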